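/- There is a universal constant $K>0$ such that the following holds. **Setting.** Let $\mathcal H$ be a finite class of predictors $h:\mathcal X\to\{0,1\}$ that contains a constant predictor, let $k\ge 2$, $m\ge 1$, $T\ge 1$ be integers, $\alpha\ge 0$, $0<\gamma\le 1$. For a randomized policy $\pi\in\Delta\mathcal H$ put $\pi(x)=\Pr_{h\sim\pi}[h(x)=1]$. Given $d^1,\dots,d^m:\mathcal X^2\to[0,1]$, $\pi$ has an $(\alpha,\gamma)$-violation on $(x,x')$ if $\frac1m\sum_{i=1}^m \mathbf 1[\pi(x)-\pi(x')-d^i(x,x')>\alpha]\ge\gamma$. A panel with distance functions $d^1,\dots,d^m$ reports, for a policy $\pi$ and $\bar x\in\mathcal X^k$, some pair $(\bar x^s,\bar x^l)$, $s\ne l$, on which $\pi$ has an $(\alpha,\gamma)$-violation, if there is one, and otherwise a default pair $(v,v)$ (no violation). In each round $t=1,\dots,T$ the learner deploys $\pi^t\in\Delta\mathcal H$; an adaptive adversary, who knows the past, picks individuals $\bar x^t\in\mathcal X^k$, labels $\bar y^t\in\{0,1\}^k$ and a panel $\bar j^t$ of $m$ auditors; the learner draws $h^t\sim\pi^t$ and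 sees $\bar y^{t,i}$ only where $h^t(\bar x^{t,i})=1$; the panel reports a pair $\rho^t=(\rho^{t,1},\rho^{t,2})$ for $(\pi^t,\bar x^t)$. Let $Error(\pi,\bar x,\bar y)=\mathbb E_{h\sim\pi}\#\{i: h(\bar x^i)\ne\bar y^i\}$, let $Unfair^{\alpha,\gamma}(\pi^t,\bar x^t,\bar j^t)\in\{0,1\}$ indicate that $\bar j^t$ reports a violation, and let $Q_{\alpha',\gamma}$ be the set of $\pi\in\Delta\mathcal H$ on which, at level $(\alpha',\gamma)$, no panel $\bar j^t$ reports a violation for $\bar x^t$ in any round $t\le T$ (fairness in hindsight). **Algorithm.** Let $C\ge1$ be an integer with $|C-T^{1/5}|<1$ (that is, $C=T^{1/5}$ up to rounding) and $D=2k+4C$. In round $t$ the reduction forms $\bar{\bar x}^t\in\mathcal X^{k+2C}$ by appending to $\bar x^t$ first $C$ copies of $\rho^{t,1}$ and then $C$ copies of $\rho^{t,2}$, forms $\bar{\bar y}^t$ by appending $C$ zeros and $C$ ones to $\bar y^t$, and sets $\ell^t=(1-\bar{\bar y}^t,\tfrac12,\dots,\tfrac12)\in[0,1]^D$ and $a^t_h=(h(\bar{\bar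 x}^t),1-h(\bar{\bar x}^t))\in\{0,1\}^D$. The policies are those of the semi-bandit algorithm Exp2 on this instance: $\pi^t(h)\propto\exp\big(-\eta\sum_{\tau<t}\langle a^\tau_h,\hat\ell^\tau\rangle\big)$, with $\hat\ell^{\tau,i}=a^{\tau,i}_{h^\tau}\,\ell^{\tau,i}/\Pr_{h\sim\pi^\tau}[a^{\tau,i}_h=1]$ (and $\hat\ell^{\tau,i}=0$ if that probability is $0$) and $\eta=\frac1D\sqrt{\log|\mathcal H|/(DT)}$. **Claim.** Simultaneously for every $\varepsilon\in[0,\alpha]$, with expectations over the draws $h^t\sim\pi^t$: 1. (Accuracy) For every fixed policy $\pi^*$ that lies in $Q_{\alpha-\varepsilon,\gamma}$ on every realization, $$\mathbb E\Big[\sum_{t=1}^T Error(\pi^t,\bar x^t,\bar y^t)-\sum_{t=1}^T Error(\pi^*,\bar x^t,\bar y^t)\Big]\le K\,k^{3/2}\,T^{4/5}\,(\log|\mathcal H|)^{1/2}.$$ If the adversary fixes individuals, labels and panels of all rounds in advance (the reports $\rho^t$ still depend on $\pi^t$), then also $$\mathbb E\Big[\sum_{t=1}^T Error(\pi^t,\bar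 x^t,\bar y^t)-\min_{\pi^*\in Q_{\alpha-\varepsilon,\gamma}}\sum_{t=1}^T Error(\pi^*,\bar x^t,\bar y^t)\Big]\le K\,k^{3/2}\,T^{4/5}\,(\log|\mathcal H|)^{1/2}.$$ 2. (Fairness) If $\varepsilon>0$, then $$\mathbb E\Big[\sum_{t=1}^T Unfair^{\alpha,\gamma}(\pi^t,\bar x^t,\bar j^t)\Big]\le K\,\frac1\varepsilon\,k^{3/2}\,T^{4/5}\,(\log|\mathcal H|)^{1/2}.$$ -/

import Mathlib

open scoped BigOperators

universe u

namespace FairOnline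

/-- The numerical value of a label: `1` for `true`, `0` for `false`. -/
def ind (b : Bool) : ℝ := if b then 1 else 0

/-! ### Policies, fairness violations, panels -/

/-- Randomized policies over a finite class `H` of binary predictors: probability vectors on `H`. -/
abbrev Policy {X : Type u} (H : Finset (X → Bool)) : Type u := stdSimplex ℝ H

/-- `π(x)`: the probability that a hypothesis drawn from `π` predicts `1` on `x`. -/
noncomputable def Policy.prob {X : Type u} {H : Finset (X → Bool)} (π : Policy H) (x : X) : ℝ :=
  ∑ h : H, π.1 h * ind (h.1 x)

/-- `π` has an `(α, γ)`-violation on `(x, x')` with respect to the distance functions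
`d 0, …, d (m - 1)`: at least a `γ` fraction of them see an `α`-violation. -/
def IsViolation {X : Type u} {H : Finset (X → Bool)} {m : ℕ}
    (d : Fin m → X → X → unitInterval) (α γ : ℝ) (π : Policy H) (x x' : X) : Prop :=
  γ ≤ (1 / (m : ℝ)) * ∑ i : Fin m, if α < π.prob x - π.prob x' - (d i x x' : ℝ) then (1 : ℝ) else 0

/-- A panel of `m` auditors for `k`-tuples of individuals.  At every level `(α, γ)` it reports one
ordered pair of distinct positions on which the policy has an `(α, γ)`-violation if there is such
a pair (which one is up to the panel), and `none` if there is no such pair. -/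
structure Panel {X : Type u} (H : Finset (X → Bool)) (k m : ℕ) where
  dist : Fin m → X → X → unitInterval
  report : ℝ → ℝ → Policy H → (Fin k → X) → Option (Fin k × Fin k)
  violation_of_report_eq_some : ∀ (α γ : ℝ) (π : Policy H) (x : Fin k → X) (s l : Fin k),
    report α γ π x = some (s, l) → s ≠ l ∧ IsViolation dist α γ π (x s) (x l)
  no_violation_of_report_eq_none : ∀ (α γ : ℝ) (π : Policy H) (x : Fin k → X),
    report α γ π x = none → ∀ s l : Fin k, s ≠ l → ¬ IsViolation dist α γ π (x s) (x l)

/-- The pair of contexts shown to the learner; the default pair `(v, v)` if there is no violation. -/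
def Panel.reportedPair {X : Type u} {H : Finset (X → Bool)} {k m : ℕ} (j : Panel H k m) (v : X)
    (α γ : ℝ) (π : Policy H) (x : Fin k → X) : X × X :=
  match j.report α γ π x with
  | some (s, l) => (x s, x l)
  | none => (v, v)

/-! ### Losses -/

/-- Misclassification loss: the expected number of errors, among the `k` individuals, of a
hypothesis drawn from `π`. -/
noncomputable def error {X : Type u} {H : Finset (X → Bool)} {k : ℕ} (π : Policy H)
    (x : Fin k → X) (y : Fin k → Bool) : ℝ :=
  ∑ h : H, π.1 h * ∑ i : Fin k, if h.1 (x i) ≠ y i then (1 : ℝ) else 0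

/-- Unfairness loss: `1` if the panel reports an `(α, γ)`-violation, `0` otherwise. -/
noncomputable def unfair {X : Type u} {H : Finset (X → Bool)} {k m : ℕ} (α γ : ℝ) (π : Policy H)
    (x : Fin k → X) (j : Panel H k m) : ℝ :=
  if j.report α γ π x = none then 0 else 1

/-! ### The environment with one-sided feedback -/

/-- What the environment selects in one round: individuals, their labels, a panel. -/
structure Round {X : Type u} (H : Finset (X → Bool)) (k m : ℕ) where
  individuals : Fin k → X
  labels : Fin k → Bool
  panel : Panel H k m

/-- An adaptive environment: the choice in round `t` (rounds are numbered from `0`) is an arbitrary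
function of the hypotheses drawn in the earlier rounds.  These determine everything else that has
happened, including the policy deployed in round `t`. -/
abbrev Environment {X : Type u} (H : Finset (X → Bool)) (k m : ℕ) : Type u :=
  (t : ℕ) → (Fin t → H) → Round H k m

/-- The environment fixed individuals, labels and panels of all rounds in advance. -/
def Environment.IsOblivious {X : Type u} {H : Finset (X → Bool)} {k m : ℕ}
    (env : Environment H k m) : Prop :=
  ∀ (t : ℕ) (hist hist' : Fin t → H), env t hist = env t hist'

/-! ### Contextual combinatorial semi-bandits and Exp2 -/

/-- One semi-bandit round: the action vector of every hypothesis (the predictions on the contexts of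
the round) and the loss vector, both indexed by coordinates `ι`. -/
structure SemiBanditRound {X : Type u} (H : Finset (X → Bool)) (ι : Type) where
  action : H → ι → ℝ
  loss : ι → ℝ

/-- An adaptive semi-bandit environment: the round may depend on the hypotheses drawn before and on
the policy that the learner has deployed for this round, but not on the current draw. -/
abbrev SemiBanditEnv {X : Type u} (H : Finset (X → Bool)) (ι : Type) : Type u :=
  (t : ℕ) → (Fin t → H) → Policy H → SemiBanditRound H ι

/-- The exponential weights policy for the cumulative (estimated) losses `L`. -/
noncomputable def expWeights {X : Type u} {H : Finset (X → Bool)} [Nonempty H] (η : ℝ)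
    (L : H → ℝ) : Policy H :=
  ⟨fun h => Real.exp (-η * L h) / ∑ g : H, Real.exp (-η * L g), by
    have hpos : 0 < ∑ g : H, Real.exp (-η * L g) :=
      Finset.sum_pos (fun g _ => Real.exp_pos _) Finset.univ_nonempty
    refine ⟨fun h => div_nonneg (Real.exp_pos _).le hpos.le, ?_⟩
    rw [← Finset.sum_div]
    exact div_self hpos.ne'⟩

/-- The importance-weighted estimate of the loss vector when `h` was drawn from `π`.  It depends
only on the losses of the coordinates selected by the action of `h`; the observed loss is divided by
the probability, under `π`, that the coordinate is selected. -/
noncomputable def lossEstimate {X : Type u} {H : Finset (X → Bool)} {ι : Type}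
    (r : SemiBanditRound H ι) (π : Policy H) (h : H) (i : ι) : ℝ :=
  r.action h i * r.loss i / ∑ g : H, π.1 g * r.action g i

/-- The cumulative estimated losses of all hypotheses that Exp2, run with learning rate `η`, has
formed after `t` rounds in which the hypotheses `hist` were drawn. -/
noncomputable def exp2Estimate {X : Type u} {H : Finset (X → Bool)} [Nonempty H] {ι : Type}
    [Fintype ι] (η : ℝ) (sb : SemiBanditEnv H ι) : (t : ℕ) → (Fin t → H) → H → ℝ
  | 0, _ => fun _ => 0
  | t + 1, hist =>
    let past : Fin t → H := fun i => hist i.castSucc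
    let L : H → ℝ := exp2Estimate η sb t past
    let π : Policy H := expWeights η L
    let r : SemiBanditRound H ι := sb t past π
    fun g => L g + ∑ i : ι, r.action g i * lossEstimate r π (hist (Fin.last t)) i

/-- The policy deployed by Exp2 in round `t`. -/
noncomputable def exp2Policy {X : Type u} {H : Finset (X → Bool)} [Nonempty H] {ι : Type}
    [Fintype ι] (η : ℝ) (sb : SemiBanditEnv H ι) (t : ℕ) (hist : Fin t → H) : Policy H :=
  expWeights η (exp2Estimate η sb t hist)

/-! ### The reduction -/

/-- Positions of the augmented sample: the `k` individuals, `C` copies of the first and `C` copies of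
the second individual of the reported pair. -/
abbrev Aug (k C : ℕ) : Type := Fin k ⊕ (Fin C ⊕ Fin C)

/-- Coordinates of the semi-bandit instance: two blocks of length `k + 2C`. -/
abbrev Coord (k C : ℕ) : Type := Aug k C ⊕ Aug k C

def augContexts {X : Type u} {k : ℕ} (C : ℕ) (x : Fin k → X) (ρ : X × X) : Aug k C → X :=
  Sum.elim x (Sum.elim (fun _ => ρ.1) (fun _ => ρ.2))

def augLabels {k : ℕ} (C : ℕ) (y : Fin k → Bool) : Aug k C → Bool :=
  Sum.elim y (Sum.elim (fun _ => false) (fun _ => true))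

/-- The loss vector: one minus the label on the first block, `1 / 2` on the second. -/
noncomputable def reductionLoss {k : ℕ} (C : ℕ) (y : Fin k → Bool) : Coord k C → ℝ :=
  Sum.elim (fun i => 1 - ind (augLabels C y i)) (fun _ => 1 / 2)

/-- The action vector of `h`: its predictions on the augmented sample, then their opposites. -/
def reductionAction {X : Type u} {k : ℕ} (C : ℕ) (x : Fin k → X) (ρ : X × X) (h : X → Bool) :
    Coord k C → ℝ :=
  Sum.elim (fun i => ind (h (augContexts C x ρ i))) (fun i => 1 - ind (h (augContexts C x ρ i)))

/-- The semi-bandit environment that the reduction generates: in each round, the panel of the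
round audits the deployed policy, and its report enters the augmented sample. -/
noncomputable def reductionEnv {X : Type u} {H : Finset (X → Bool)} {k m : ℕ}
    (env : Environment H k m) (v : X) (α γ : ℝ) (C : ℕ) : SemiBanditEnv H (Coord k C) :=
  fun t hist π =>
    let r := env t hist
    let ρ := r.panel.reportedPair v α γ π r.individuals
    { action := fun h => reductionAction C r.individuals ρ h.1
      loss := reductionLoss C r.labels }

/-- The learning rate of Exp2 for `T` rounds, `n` hypotheses and dimension `D`, when losses are
first divided by `D` so that the loss of every action is at most `1`. -/
noncomputable def exp2Rate (T n D : ℕ) : ℝ :=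
  Real.sqrt (Real.log n / ((D : ℝ) * T)) / D

/-- The policy deployed in round `t` by Exp2, run for `T` rounds on the semi-bandit environment
generated by the reduction with parameter `C`. -/
noncomputable def learner {X : Type u} {H : Finset (X → Bool)} [Nonempty H] {k m : ℕ}
    (env : Environment H k m) (v : X) (α γ : ℝ) (C T : ℕ) (t : ℕ) (hist : Fin t → H) : Policy H :=
  exp2Policy (exp2Rate T H.card (2 * k + 4 * C)) (reductionEnv env v α γ C) t hist

/-! ### Runs, expectations, regret -/

/-- The hypotheses drawn before round `t`. -/
def past {A : Type u} {T : ℕ} (ω : Fin T → A) (t : Fin T) : Fin t → A :=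
  fun i => ω (Fin.castLE t.isLt.le i)

/-- Expectation of `F (h⁰, …, h^{T-1})` when `h^t` is drawn from the policy `P t (h⁰, …, h^{t-1})`. -/
noncomputable def expectation {X : Type u} {H : Finset (X → Bool)}
    (P : (t : ℕ) → (Fin t → H) → Policy H) (T : ℕ) (F : (Fin T → H) → ℝ) : ℝ :=
  ∑ ω : Fin T → H, (∏ t : Fin T, (P t (past ω t)).1 (ω t)) * F ω

/-- The policies that are `(α, γ)`-fair in hindsight: in no round of the run `ω` does the panel of
that round find an `(α, γ)`-violation. -/
def fairPolicies {X : Type u} {H : Finset (X → Bool)} {k m T : ℕ} (env : Environment H k m)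
    (α γ : ℝ) (ω : Fin T → H) : Set (Policy H) :=
  {π | ∀ t : Fin T,
    (env t (past ω t)).panel.report α γ π (env t (past ω t)).individuals = none}

/-- Cumulative misclassification loss of a fixed policy on the run `ω`. -/
noncomputable def fixedError {X : Type u} {H : Finset (X → Bool)} {k m T : ℕ}
    (env : Environment H k m) (ω : Fin T → H) (π : Policy H) : ℝ :=
  ∑ t : Fin T, error π (env t (past ω t)).individuals (env t (past ω t)).labels

/-- Cumulative misclassification loss of the deployed policies `P` on the run `ω`. -/
noncomputable def learnerError {X : Type u} {H : Finset (X → Bool)} {k m T : ℕ}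
    (env : Environment H k m) (P : (t : ℕ) → (Fin t → H) → Policy H) (ω : Fin T → H) : ℝ :=
  ∑ t : Fin T, error (P t (past ω t)) (env t (past ω t)).individuals (env t (past ω t)).labels

/-- Error regret on the run `ω` against the comparator class `U`. -/
noncomputable def errorRegret {X : Type u} {H : Finset (X → Bool)} {k m T : ℕ}
    (env : Environment H k m) (P : (t : ℕ) → (Fin t → H) → Policy H) (U : Set (Policy H))
    (ω : Fin T → H) : ℝ :=
  learnerError env P ω - sInf (fixedError env ω '' U)

/-- Number of rounds of the run `ω` in which the deployed policy has an `(α, γ)`-violation. -/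
noncomputable def learnerUnfair {X : Type u} {H : Finset (X → Bool)} {k m T : ℕ}
    (env : Environment H k m) (α γ : ℝ) (P : (t : ℕ) → (Fin t → H) → Policy H)
    (ω : Fin T → H) : ℝ :=
  ∑ t : Fin T, unfair α γ (P t (past ω t)) (env t (past ω t)).individuals (env t (past ω t)).panel

end FairOnline

namespace FairOnline

variable {X : Type u} {H : Finset (X → Bool)}

/-! ### Expectations over runs -/

section Expectation

variable (P : (t : ℕ) → (Fin t → H) → Policy H)

/-! Up to a constant, the semi-bandit loss of `h` is half its number of errors on the augmented
sample. There the copies of the reported pair contribute `C` times the difference of the two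
predictions of `h`. Hence twice the semi-bandit regret against `πstar` is the error regret plus `C`
times the sum over rounds of gap(π^t) - gap(`πstar`) on the reported pairs.

If `πstar` is fair at level `α - ε`, each reported violation makes this gap difference at least `ε`:
some auditor sees an `α`-violation by π^t but no `(α - ε)`-violation by `πstar`, and the auditor's
distance cancels. On the default pair both gaps vanish. So E[error regret] + `C * ε` * E[unfairness]
is at most twice the regret of Exp2 (`expectation_regret_add_unfair_le`).

The regret of Exp2 is at most log|H|/η + TηD²/2 (`exp2_regret`). This follows from telescoping the
log of the total weight: the estimates are unbiased, and their second moment under the deployed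
policy is at most D². Reports may depend on the deployed policy, since the argument conditions on
everything before the draw. With the chosen η the bound is of order D^(3/2) √(T log|H|), and D = O(k
T^(1/5)) gives the rate.

Accuracy drops the unfairness term. For fairness the comparator is the constant predictor, which is
always fair; its error regret is at least -kT, and dividing by C ≈ T^(1/5) brings kT down to the
same rate. If |H| = 1 then η = 0, and the claim holds because there is only one policy. -/

theorem past_snoc_castSucc {A : Type u} {T : ℕ} (ω : Fin T → A) (h : A) (t : Fin T) :
    past (Fin.snoc ω h : Fin (T + 1) → A) t.castSucc = past ω t := by
  funext i
  exact Fin.snoc_castSucc (α := fun _ => A) h ω (Fin.castLE t.isLt.le i)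

theorem past_snoc_last {A : Type u} {T : ℕ} (ω : Fin T → A) (h : A) :
    past (Fin.snoc ω h : Fin (T + 1) → A) (Fin.last T) = ω := by
  funext i
  exact Fin.snoc_castSucc (α := fun _ => A) h ω i

theorem expectation_zero (F : (Fin 0 → H) → ℝ) : expectation P 0 F = F Fin.elim0 := by
  simp only [expectation, Finset.univ_eq_empty, Finset.prod_empty, one_mul]
  rw [Fintype.sum_unique]
  congr 1

theorem expectation_succ (T : ℕ) (F : (Fin (T + 1) → H) → ℝ) :
    expectation P (T + 1) F =
      expectation P T fun ω => ∑ h : H, (P T ω).1 h * F (Fin.snoc ω h) := by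
  unfold expectation
  rw [← (Fin.snocEquiv fun _ : Fin (T + 1) => (H : Type u)).sum_comp, Fintype.sum_prod_type,
    Finset.sum_comm]
  refine Finset.sum_congr rfl fun ω _ => ?_
  rw [Finset.mul_sum]
  refine Finset.sum_congr rfl fun h _ => ?_
  change (∏ t : Fin (T + 1), (P t.1 (past (Fin.snoc ω h : Fin (T + 1) → H) t)).1
    ((Fin.snoc ω h : Fin (T + 1) → H) t)) * F (Fin.snoc ω h) = _
  rw [Fin.prod_univ_castSucc, mul_assoc]
  congr 1
  · refine Finset.prod_congr rfl fun t _ => ?_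
    rw [past_snoc_castSucc, Fin.snoc_castSucc]
    rfl
  · rw [past_snoc_last, Fin.snoc_last]
    rfl

theorem expectation_mono {T : ℕ} {F G : (Fin T → H) → ℝ} (h : ∀ ω, F ω ≤ G ω) :
    expectation P T F ≤ expectation P T G :=
  Finset.sum_le_sum fun ω _ =>
    mul_le_mul_of_nonneg_left (h ω) (Finset.prod_nonneg fun t _ => (P t (past ω t)).2.1 (ω t))

theorem expectation_add {T : ℕ} (F G : (Fin T → H) → ℝ) :
    expectation P T (fun ω => F ω + G ω) = expectation P T F + expectation P T G := by
  simp only [expectation, mul_add, Finset.sum_add_distrib]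

theorem expectation_const_mul {T : ℕ} (c : ℝ) (F : (Fin T → H) → ℝ) :
    expectation P T (fun ω => c * F ω) = c * expectation P T F := by
  simp only [expectation, Finset.mul_sum]
  exact Finset.sum_congr rfl fun ω _ => by ring

theorem expectation_const (T : ℕ) (c : ℝ) : expectation P T (fun _ => c) = c := by
  induction T with
  | zero => exact expectation_zero P _
  | succ T ih =>
    rw [expectation_succ]
    simp only [← Finset.sum_mul]
    refine Eq.trans ?_ ih
    congr 1
    funext ω
    rw [(P T ω).2.2, one_mul]

/-- Telescoping a potential `Φ` whose expected increase in each round dominates `g - c`. -/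
theorem expectation_sum_le_of_potential (g Φ : (t : ℕ) → (Fin t → H) → ℝ) (c : ℝ)
    (hstep : ∀ t (hist : Fin t → H),
      g t hist ≤ c + ∑ h : H, (P t hist).1 h * Φ (t + 1) (Fin.snoc hist h) - Φ t hist) (T : ℕ) :
    expectation P T (fun ω => ∑ t : Fin T, g t (past ω t)) ≤
      T * c + expectation P T (Φ T) - Φ 0 Fin.elim0 := by
  induction T with
  | zero => simp [expectation_zero]
  | succ T ih =>
    have hsum : ∀ ω : Fin T → H,
        ∑ h : H, (P T ω).1 h * ∑ t : Fin (T + 1), g t.1 (past (Fin.snoc ω h : Fin (T + 1) → H) t) =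
          ∑ t : Fin T, g t (past ω t) + g T ω := fun ω => by
      simp only [Fin.sum_univ_castSucc, past_snoc_castSucc, past_snoc_last]
      rw [← Finset.sum_mul, (P T ω).2.2, one_mul]
      rfl
    rw [expectation_succ]
    simp only [hsum]
    rw [expectation_add, expectation_succ P T (Φ (T + 1))]
    have h := expectation_mono P fun ω => hstep T ω
    simp only [sub_eq_add_neg, neg_eq_neg_one_mul (Φ T _)] at h
    rw [expectation_add, expectation_add, expectation_const, expectation_const_mul] at h
    push_cast
    linarith

end Expectation

/-! ### The regret of Exp2 -/

section Exp2

variable {ι : Type}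

/-- Actions and losses lie in the unit interval. -/
structure SemiBanditRound.IsBounded (r : SemiBanditRound H ι) : Prop where
  action_nonneg : ∀ h i, 0 ≤ r.action h i
  action_le_one : ∀ h i, r.action h i ≤ 1
  loss_nonneg : ∀ i, 0 ≤ r.loss i
  loss_le_one : ∀ i, r.loss i ≤ 1

theorem SemiBanditRound.IsBounded.prob_nonneg {r : SemiBanditRound H ι} (hr : r.IsBounded) (π : Policy H) (i : ι) : 0 ≤ ∑ g : H, π.1 g * r.action g i :=
  Finset.sum_nonneg fun g _ => mul_nonneg (π.2.1 g) (hr.action_nonneg g i)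

theorem SemiBanditRound.IsBounded.lossEstimate_nonneg {r : SemiBanditRound H ι} (hr : r.IsBounded) (π : Policy H) (h : H) (i : ι) :
    0 ≤ lossEstimate r π h i :=
  div_nonneg (mul_nonneg (hr.action_nonneg h i) (hr.loss_nonneg i)) (hr.prob_nonneg π i)

variable [Fintype ι]

/-! ### Exponential inequalities for nonnegative losses -/

theorem exp_neg_le_quadratic {x : ℝ} (hx : 0 ≤ x) : Real.exp (-x) ≤ 1 - x + x ^ 2 / 2 := by
  rw [Real.exp_neg, inv_le_iff_one_le_mul₀ (Real.exp_pos x)]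
  have h1 := Real.quadratic_le_exp_of_nonneg hx
  have h2 : 0 ≤ 1 - x + x ^ 2 / 2 := by nlinarith [sq_nonneg (x - 1)]
  -- (1 + x + x²/2)(1 - x + x²/2) = 1 + x⁴/4 ≥ 1.
  nlinarith [mul_le_mul_of_nonneg_left h1 h2, sq_nonneg (x ^ 2)]

/-- Average the quadratic bound on exp(-z), then use log u ≤ u - 1. No upper bound on `Z` is needed,
which matters because importance-weighted estimates can be arbitrarily large. -/
theorem log_sum_exp_neg_le {A : Type*} [Fintype A] (p Z : A → ℝ) (hp : ∀ a, 0 ≤ p a)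
    (hp1 : ∑ a, p a = 1) (hZ : ∀ a, 0 ≤ Z a) :
    Real.log (∑ a, p a * Real.exp (-Z a)) ≤ -∑ a, p a * Z a + (∑ a, p a * Z a ^ 2) / 2 := by
  have hpos : 0 < ∑ a, p a * Real.exp (-Z a) := by
    refine Finset.sum_pos' (fun a _ => mul_nonneg (hp a) (Real.exp_pos _).le) ?_
    by_contra! hcon
    have : ∑ a, p a = 0 := Finset.sum_eq_zero fun a ha =>
      le_antisymm (nonpos_of_mul_nonpos_left (hcon a ha) (Real.exp_pos _)) (hp a)
    linarith
  have hle : ∑ a, p a * Real.exp (-Z a) ≤ ∑ a, p a * (1 - Z a + Z a ^ 2 / 2) :=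
    Finset.sum_le_sum fun a _ => mul_le_mul_of_nonneg_left (exp_neg_le_quadratic (hZ a)) (hp a)
  have hexp : ∑ a, p a * (1 - Z a + Z a ^ 2 / 2) =
      1 - ∑ a, p a * Z a + (∑ a, p a * Z a ^ 2) / 2 := by
    conv_rhs => rw [← hp1]
    rw [Finset.sum_div, ← Finset.sum_sub_distrib, ← Finset.sum_add_distrib]
    exact Finset.sum_congr rfl fun a _ => by ring
  linarith [Real.log_le_sub_one_of_pos hpos]

/-- The loss of the action of `h` in a semi-bandit round. -/
noncomputable def SemiBanditRound.cost (r : SemiBanditRound H ι) (h : H) : ℝ :=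
  ∑ i, r.action h i * r.loss i

/-- The estimated loss of the action of `g` when `h` was drawn from `π`. -/
noncomputable def SemiBanditRound.costEstimate (r : SemiBanditRound H ι) (π : Policy H)
    (h g : H) : ℝ :=
  ∑ i, r.action g i * lossEstimate r π h i

/-! ### Mean and second moment of the importance-weighted estimates -/

namespace SemiBanditRound

variable {r : SemiBanditRound H ι} {π : Policy H}

theorem IsBounded.costEstimate_nonneg (hr : r.IsBounded) (h g : H) : 0 ≤ r.costEstimate π h g :=
  Finset.sum_nonneg fun i _ => mul_nonneg (hr.action_nonneg g i) (hr.lossEstimate_nonneg π h i)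

/-- Under a policy of full support the estimates are unbiased. -/
theorem IsBounded.sum_costEstimate (hr : r.IsBounded) (hπ : ∀ h, 0 < π.1 h) (g : H) :
    ∑ h : H, π.1 h * r.costEstimate π h g = r.cost g := by
  simp only [costEstimate, cost, Finset.mul_sum]
  rw [Finset.sum_comm]
  refine Finset.sum_congr rfl fun i _ => ?_
  have hsum : ∑ h : H, π.1 h * (r.action g i * lossEstimate r π h i) =
      r.action g i * r.loss i * ((∑ h : H, π.1 h * r.action h i) / ∑ h : H, π.1 h * r.action h i) := by
    rw [Finset.sum_div, Finset.mul_sum]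
    exact Finset.sum_congr rfl fun h _ => by rw [lossEstimate]; ring
  rw [hsum]
  -- A coordinate of probability zero is selected by no hypothesis, by full support, so both sides
  -- vanish there, in agreement with division by zero being zero.
  by_cases hp : ∑ h : H, π.1 h * r.action h i = 0
  · have h0 := (Finset.sum_eq_zero_iff_of_nonneg fun h _ =>
      mul_nonneg (hπ h).le (hr.action_nonneg h i)).1 hp g (Finset.mem_univ g)
    rw [(mul_eq_zero.1 h0).resolve_left (hπ g).ne']
    simp
  · rw [div_self hp, mul_one]

/-- Cauchy–Schwarz over the coordinates gives the dimension factor. The squared numerators lie in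
[0, 1], so they are bounded by products of two actions, whose average will cancel the squared
probability. -/
theorem IsBounded.sq_costEstimate_le (hr : r.IsBounded) (h g : H) :
    r.costEstimate π h g ^ 2 ≤ Fintype.card ι *
      ∑ i, r.action g i * r.action h i / (∑ f : H, π.1 f * r.action f i) ^ 2 := by
  refine (sq_sum_le_card_mul_sum_sq).trans ?_
  rw [Finset.card_univ]
  refine mul_le_mul_of_nonneg_left (Finset.sum_le_sum fun i _ => ?_) (Nat.cast_nonneg _)
  rw [lossEstimate, mul_div_assoc', div_pow]
  refine div_le_div_of_nonneg_right ?_ (sq_nonneg _)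
  have ha := hr.action_nonneg g i
  have hb := hr.action_nonneg h i
  have hc := hr.loss_nonneg i
  have h1 : r.action g i * (r.action h i * r.loss i) ≤ r.action g i * r.action h i := by
    rw [← mul_assoc]
    exact mul_le_of_le_one_right (mul_nonneg ha hb) (hr.loss_le_one i)
  have h2 : r.action g i * r.action h i ≤ 1 :=
    mul_le_one₀ (hr.action_le_one g i) hb (hr.action_le_one h i)
  have h3 : 0 ≤ r.action g i * (r.action h i * r.loss i) := mul_nonneg ha (mul_nonneg hb hc)
  nlinarith

/-- Averaging over independent `g` and `h` drawn from `π` turns the product of their actions at `i`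
into `p i ^ 2`. Each coordinate then contributes at most 1, however small `p i` is, so no
exploration is required. -/
theorem IsBounded.sum_sq_costEstimate_le (hr : r.IsBounded) :
    ∑ h : H, π.1 h * ∑ g : H, π.1 g * r.costEstimate π h g ^ 2 ≤ (Fintype.card ι : ℝ) ^ 2 := by
  set p : ι → ℝ := fun i => ∑ f : H, π.1 f * r.action f i with hp
  calc ∑ h : H, π.1 h * ∑ g : H, π.1 g * r.costEstimate π h g ^ 2
      ≤ ∑ h : H, π.1 h * ∑ g : H, π.1 g *
          (Fintype.card ι * ∑ i, r.action g i * r.action h i / p i ^ 2) :=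
        Finset.sum_le_sum fun h _ => mul_le_mul_of_nonneg_left (Finset.sum_le_sum fun g _ =>
          mul_le_mul_of_nonneg_left (hr.sq_costEstimate_le h g) (π.2.1 g)) (π.2.1 h)
    _ = Fintype.card ι * ∑ i, p i * p i / p i ^ 2 := by
        have h1 : ∀ i, p i * p i / p i ^ 2 = ∑ h : H, ∑ g : H,
            π.1 h * (π.1 g * (r.action g i * r.action h i / p i ^ 2)) := fun i => by
          conv_lhs => rw [hp]
          simp only
          rw [Finset.sum_mul_sum, Finset.sum_div]
          refine Finset.sum_congr rfl fun h _ => ?_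
          rw [Finset.sum_div]
          exact Finset.sum_congr rfl fun g _ => by ring
        simp only [h1]
        rw [Finset.sum_comm, Finset.mul_sum]
        refine Finset.sum_congr rfl fun h _ => ?_
        rw [Finset.sum_comm, Finset.mul_sum, Finset.mul_sum]
        refine Finset.sum_congr rfl fun g _ => ?_
        simp only [Finset.mul_sum]
        exact Finset.sum_congr rfl fun i _ => by ring
    _ ≤ Fintype.card ι * ∑ _i : ι, 1 := by
        refine mul_le_mul_of_nonneg_left (Finset.sum_le_sum fun i _ => ?_) (Nat.cast_nonneg _)
        rw [← pow_two]
        -- The quotient is 0 rather than 1 when `p i = 0`.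
        exact div_self_le_one _
    _ = (Fintype.card ι : ℝ) ^ 2 := by simp [pow_two]

end SemiBanditRound

/-- Minus the logarithm of the total weight, up to the factor `η`. -/
noncomputable def softMin (η : ℝ) (L : H → ℝ) : ℝ :=
  -(Real.log (∑ g : H, Real.exp (-η * L g)) / η)

theorem softMin_le {η : ℝ} (hη : 0 < η) (L : H → ℝ) (h : H) : softMin η L ≤ L h := by
  have hle : Real.exp (-η * L h) ≤ ∑ g : H, Real.exp (-η * L g) :=
    Finset.single_le_sum (f := fun g : H => Real.exp (-η * L g))
      (fun _ _ => (Real.exp_pos _).le) (Finset.mem_univ h)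
  have hlog := (Real.le_log_iff_exp_le ((Real.exp_pos _).trans_le hle)).2 hle
  rw [softMin, neg_le, le_div_iff₀ hη]
  linarith

variable [Nonempty H] (η : ℝ) (sb : SemiBanditEnv H ι)

theorem exp2Estimate_snoc (t : ℕ) (hist : Fin t → H) (h g : H) :
    exp2Estimate η sb (t + 1) (Fin.snoc hist h) g = exp2Estimate η sb t hist g +
      (sb t hist (exp2Policy η sb t hist)).costEstimate (exp2Policy η sb t hist) h g := by
  have hpast : (fun i : Fin t => (Fin.snoc hist h : Fin (t + 1) → H) i.castSucc) = hist := by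
    funext i
    exact Fin.snoc_castSucc (α := fun _ => (H : Type u)) h hist i
  have hlast : (Fin.snoc hist h : Fin (t + 1) → H) (Fin.last t) = h :=
    Fin.snoc_last (α := fun _ => (H : Type u)) h hist
  rw [exp2Estimate]
  simp only [hpast, hlast]
  rfl

theorem expWeights_pos (L : H → ℝ) (h : H) : 0 < (expWeights η L).1 h :=
  div_pos (Real.exp_pos _) (Finset.sum_pos (fun _ _ => Real.exp_pos _) Finset.univ_nonempty)

variable {η}

/-- The ratio of the new to the old total weight is the mean of exp(-ηZ) under the exponential
weights, to which `log_sum_exp_neg_le` applies. -/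
theorem softMin_add_ge (hη : 0 < η) (L Z : H → ℝ) (hZ : ∀ h, 0 ≤ Z h) :
    softMin η L + ∑ h : H, (expWeights η L).1 h * Z h
        - η / 2 * ∑ h : H, (expWeights η L).1 h * Z h ^ 2 ≤
      softMin η fun h => L h + Z h := by
  have hW : 0 < ∑ g : H, Real.exp (-η * L g) :=
    Finset.sum_pos (fun g _ => Real.exp_pos _) Finset.univ_nonempty
  have hW' : 0 < ∑ g : H, Real.exp (-η * (L g + Z g)) :=
    Finset.sum_pos (fun g _ => Real.exp_pos _) Finset.univ_nonempty
  have hratio : ∑ h : H, (expWeights η L).1 h * Real.exp (-(η * Z h)) =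
      (∑ g : H, Real.exp (-η * (L g + Z g))) / ∑ g : H, Real.exp (-η * L g) := by
    rw [Finset.sum_div]
    refine Finset.sum_congr rfl fun h _ => ?_
    change Real.exp (-η * L h) / _ * _ = _
    rw [div_mul_eq_mul_div, ← Real.exp_add]
    congr 2
    ring
  have hlog := log_sum_exp_neg_le (expWeights η L).1 (fun h => η * Z h) (expWeights η L).2.1
    (expWeights η L).2.2 fun h => mul_nonneg hη.le (hZ h)
  rw [hratio, Real.log_div hW'.ne' hW.ne'] at hlog
  have h1 : ∑ h : H, (expWeights η L).1 h * (η * Z h) =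
      η * ∑ h : H, (expWeights η L).1 h * Z h := by
    rw [Finset.mul_sum]
    exact Finset.sum_congr rfl fun h _ => by ring
  have h2 : ∑ h : H, (expWeights η L).1 h * (η * Z h) ^ 2 =
      η ^ 2 * ∑ h : H, (expWeights η L).1 h * Z h ^ 2 := by
    rw [Finset.mul_sum]
    exact Finset.sum_congr rfl fun h _ => by ring
  rw [h1, h2] at hlog
  unfold softMin
  rw [← sub_nonneg]
  have key : ∀ a b m q : ℝ, -(b / η) - (-(a / η) + m - η / 2 * q) =
      (-(η * m) + η ^ 2 * q / 2 - (b - a)) / η := fun a b m q => by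
    field_simp
    ring
  rw [key]
  exact div_nonneg (by linarith) hη.le

/-- The expected loss of a policy in a semi-bandit round. -/
noncomputable def SemiBanditRound.policyCost (r : SemiBanditRound H ι) (π : Policy H) : ℝ :=
  ∑ h : H, π.1 h * r.cost h

variable (η) in
/-- The potential of Exp2 relative to the comparator `πstar`. -/
noncomputable def exp2Potential (πstar : Policy H) (t : ℕ) (hist : Fin t → H) : ℝ :=
  softMin η (exp2Estimate η sb t hist) - ∑ h : H, πstar.1 h * exp2Estimate η sb t hist h

variable {sb}

/-- Given the past, the round and the policy are fixed. Averaging `softMin_add_ge` over the draw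
replaces estimated costs by true ones, for the learner and for `πstar`, and the quadratic term by at
most D². -/
theorem exp2_step (hη : 0 < η) (hsb : ∀ t hist π, (sb t hist π).IsBounded) (πstar : Policy H)
    (t : ℕ) (hist : Fin t → H) :
    (sb t hist (exp2Policy η sb t hist)).policyCost (exp2Policy η sb t hist)
        - (sb t hist (exp2Policy η sb t hist)).policyCost πstar ≤
      η / 2 * (Fintype.card ι : ℝ) ^ 2
        + ∑ h : H, (exp2Policy η sb t hist).1 h * exp2Potential η sb πstar (t + 1) (Fin.snoc hist h)
        - exp2Potential η sb πstar t hist := by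
  have hr := hsb t hist (exp2Policy η sb t hist)
  have hpos : ∀ h, 0 < (exp2Policy η sb t hist).1 h := expWeights_pos η _
  set π := exp2Policy η sb t hist with hπ
  set r := sb t hist π with hrdef
  set L := exp2Estimate η sb t hist with hL
  have hswap : ∀ σ : Policy H, ∑ h : H, π.1 h * ∑ g : H, σ.1 g * r.costEstimate π h g =
      r.policyCost σ := fun σ => by
    simp only [Finset.mul_sum, SemiBanditRound.policyCost]
    rw [Finset.sum_comm]
    refine Finset.sum_congr rfl fun g _ => ?_
    rw [← hr.sum_costEstimate hpos g, Finset.mul_sum]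
    exact Finset.sum_congr rfl fun h _ => by ring
  have hbound : ∀ h : H, exp2Potential η sb πstar t hist
      + ∑ g : H, π.1 g * r.costEstimate π h g
      - η / 2 * ∑ g : H, π.1 g * r.costEstimate π h g ^ 2
      - ∑ g : H, πstar.1 g * r.costEstimate π h g ≤
        exp2Potential η sb πstar (t + 1) (Fin.snoc hist h) := fun h => by
    have hs := softMin_add_ge hη L (r.costEstimate π h) (hr.costEstimate_nonneg h)
    have hsnoc : exp2Estimate η sb (t + 1) (Fin.snoc hist h) =
        fun g => L g + r.costEstimate π h g := funext fun g => exp2Estimate_snoc η sb t hist h g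
    unfold exp2Potential
    rw [hsnoc]
    simp only [mul_add, Finset.sum_add_distrib]
    change softMin η L + ∑ g : H, π.1 g * r.costEstimate π h g
      - η / 2 * ∑ g : H, π.1 g * r.costEstimate π h g ^ 2 ≤ _ at hs
    linarith
  have hsum := Finset.sum_le_sum fun h (_ : h ∈ Finset.univ) =>
    mul_le_mul_of_nonneg_left (hbound h) (hpos h).le
  have hexpand : ∑ h : H, π.1 h * (exp2Potential η sb πstar t hist
      + ∑ g : H, π.1 g * r.costEstimate π h g
      - η / 2 * ∑ g : H, π.1 g * r.costEstimate π h g ^ 2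
      - ∑ g : H, πstar.1 g * r.costEstimate π h g) =
      exp2Potential η sb πstar t hist + r.policyCost π
      - η / 2 * (∑ h : H, π.1 h * ∑ g : H, π.1 g * r.costEstimate π h g ^ 2)
      - r.policyCost πstar := by
    rw [← hswap π, ← hswap πstar]
    conv_rhs => rw [← one_mul (exp2Potential η sb πstar t hist), ← π.2.2]
    rw [Finset.sum_mul, Finset.mul_sum (a := η / 2), ← Finset.sum_add_distrib,
      ← Finset.sum_sub_distrib, ← Finset.sum_sub_distrib]
    exact Finset.sum_congr rfl fun h _ => by ring
  rw [hexpand] at hsum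
  have hvar := mul_le_mul_of_nonneg_left (hr.sum_sq_costEstimate_le (π := π)) (half_pos hη).le
  linarith

/-- The regret of Exp2 against a fixed policy, for an adaptive environment. -/
theorem exp2_regret (hη : 0 < η) (hsb : ∀ t hist π, (sb t hist π).IsBounded) (πstar : Policy H)
    (T : ℕ) :
    expectation (exp2Policy η sb) T (fun ω => ∑ t : Fin T,
        ((sb t (past ω t) (exp2Policy η sb t (past ω t))).policyCost
            (exp2Policy η sb t (past ω t))
          - (sb t (past ω t) (exp2Policy η sb t (past ω t))).policyCost πstar)) ≤
      Real.log H.card / η + T * (η / 2 * (Fintype.card ι : ℝ) ^ 2) := by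
  have h := expectation_sum_le_of_potential (exp2Policy η sb) _ (exp2Potential η sb πstar) _
    (exp2_step hη hsb πstar) T
  -- `softMin` lies below every coordinate, hence below their average under `πstar`.
  have hend : expectation (exp2Policy η sb) T (exp2Potential η sb πstar T) ≤ 0 := by
    refine (expectation_mono _ (G := fun _ => 0) fun ω => ?_).trans (expectation_const _ T 0).le
    rw [exp2Potential, sub_nonpos]
    calc softMin η (exp2Estimate η sb T ω)
        = ∑ h : H, πstar.1 h * softMin η (exp2Estimate η sb T ω) := by
          rw [← Finset.sum_mul, πstar.2.2, one_mul]
      _ ≤ _ := Finset.sum_le_sum fun h _ =>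
          mul_le_mul_of_nonneg_left (softMin_le hη _ h) (πstar.2.1 h)
  have hstart : exp2Potential η sb πstar 0 Fin.elim0 = -(Real.log H.card / η) := by
    simp [exp2Potential, softMin, exp2Estimate]
  rw [hstart] at h
  linarith

end Exp2

/-! ### The reduction -/

section Reduction

variable {k m : ℕ}

theorem ind_nonneg (b : Bool) : 0 ≤ ind b := by cases b <;> simp [ind]

theorem ind_le_one (b : Bool) : ind b ≤ 1 := by cases b <;> simp [ind]

theorem reductionEnv_isBounded (env : Environment H k m) (v : X) (α γ : ℝ) (C t : ℕ)
    (hist : Fin t → H) (π : Policy H) : (reductionEnv env v α γ C t hist π).IsBounded where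
  action_nonneg h i := by
    rcases i with i | i
    · exact ind_nonneg _
    · exact sub_nonneg.2 (ind_le_one _)
  action_le_one h i := by
    rcases i with i | i
    · exact ind_le_one _
    · exact sub_le_self _ (ind_nonneg _)
  loss_nonneg i := by
    rcases i with i | i
    · exact sub_nonneg.2 (ind_le_one _)
    · exact one_half_pos.le
  loss_le_one i := by
    rcases i with i | i
    · exact sub_le_self _ (ind_nonneg _)
    · exact one_half_lt_one.le

/-- The difference of the predictions of `π` on the two members of a pair. -/
noncomputable def Policy.gap (π : Policy H) (ρ : X × X) : ℝ := π.prob ρ.1 - π.prob ρ.2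

/-- The reduction encodes half the misclassification loss on the augmented sample, up to a constant
that does not depend on the hypothesis. -/
theorem sum_reductionAction_mul_reductionLoss (C : ℕ) (x : Fin k → X) (y : Fin k → Bool)
    (ρ : X × X) (h : X → Bool) :
    ∑ i, reductionAction C x ρ h i * reductionLoss C y i =
      1 / 2 * (∑ i, (if h (x i) ≠ y i then (1 : ℝ) else 0) + C * (ind (h ρ.1) - ind (h ρ.2)))
        + (1 / 2 * ∑ i, (1 - ind (y i)) + C) := by
  obtain ⟨e, he⟩ : ∃ e : Bool → Bool → ℝ, ∀ a b, (if a ≠ b then (1 : ℝ) else 0) = e a b :=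
    ⟨_, fun _ _ => rfl⟩
  have hpoint : ∀ a b : Bool, ind a * (1 - ind b) + (1 - ind a) * (1 / 2) =
      1 / 2 * e a b + 1 / 2 * (1 - ind b) := by
    intro a b
    rw [← he]
    cases a <;> cases b <;> norm_num [ind]
  have hsplit : ∑ i, reductionAction C x ρ h i * reductionLoss C y i =
      ∑ i : Aug k C, (1 / 2 * e (h (augContexts C x ρ i)) (augLabels C y i)
        + 1 / 2 * (1 - ind (augLabels C y i))) := by
    rw [Fintype.sum_sum_type, ← Finset.sum_add_distrib]
    exact Finset.sum_congr rfl fun i _ => hpoint _ _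
  have hfalse : ∀ a : Bool, e a false = ind a := fun a => by
    rw [← he]
    cases a <;> simp [ind]
  have htrue : ∀ a : Bool, e a true = 1 - ind a := fun a => by
    rw [← he]
    cases a <;> simp [ind]
  simp only [he]
  rw [hsplit, Fintype.sum_sum_type, Fintype.sum_sum_type, Finset.sum_add_distrib,
    ← Finset.mul_sum, ← Finset.mul_sum]
  simp only [augContexts, augLabels, Sum.elim_inl, Sum.elim_inr, Finset.sum_const,
    Finset.card_univ, Fintype.card_fin, nsmul_eq_mul, hfalse, htrue]
  -- Of the constant `C`, one half comes from the offset 1/2 of the copies labelled 0, the other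
  -- from the 1 in the error 1 - h of the copies labelled 1.
  have htt : ind true = 1 := rfl
  have hff : ind false = 0 := rfl
  rw [htt, hff]
  ring

theorem two_mul_policyCost_sub (env : Environment H k m) (v : X) (α γ : ℝ) (C t : ℕ)
    (hist : Fin t → H) (π σ σ' : Policy H) :
    2 * ((reductionEnv env v α γ C t hist π).policyCost σ
        - (reductionEnv env v α γ C t hist π).policyCost σ') =
      error σ (env t hist).individuals (env t hist).labels
        - error σ' (env t hist).individuals (env t hist).labels
        + C * (σ.gap ((env t hist).panel.reportedPair v α γ π (env t hist).individuals)
          - σ'.gap ((env t hist).panel.reportedPair v α γ π (env t hist).individuals)) := by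
  set ρ := (env t hist).panel.reportedPair v α γ π (env t hist).individuals
  have hcost : ∀ τ : Policy H, (reductionEnv env v α γ C t hist π).policyCost τ =
      1 / 2 * (error τ (env t hist).individuals (env t hist).labels + C * τ.gap ρ)
        + (1 / 2 * ∑ i, (1 - ind ((env t hist).labels i)) + C) := fun τ => by
    have hh : ∀ h : H, (reductionEnv env v α γ C t hist π).cost h = _ := fun h =>
      sum_reductionAction_mul_reductionLoss C (env t hist).individuals (env t hist).labels ρ h.1
    unfold SemiBanditRound.policyCost
    simp only [hh]
    set c := 1 / 2 * ∑ i, (1 - ind ((env t hist).labels i)) + (C : ℝ)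
    have hc : c = ∑ h : H, τ.1 h * c := by rw [← Finset.sum_mul, τ.2.2, one_mul]
    conv_rhs => rw [hc]
    unfold error Policy.gap Policy.prob
    rw [← Finset.sum_sub_distrib, Finset.mul_sum (a := (C : ℝ)),
      ← Finset.sum_add_distrib, Finset.mul_sum (a := (1 / 2 : ℝ)), ← Finset.sum_add_distrib]
    exact Finset.sum_congr rfl fun h _ => by ring
  rw [hcost, hcost]
  ring

/-- Otherwise every auditor counted against `π` at level `α` would also be counted against `σ` at
level `β`, so `σ` would reach the fraction `γ` too. -/
theorem Policy.exists_of_isViolation_of_not {d : Fin m → X → X → unitInterval} {α β γ : ℝ}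
    {π σ : Policy H} {x x' : X} (hπ : IsViolation d α γ π x x') (hσ : ¬ IsViolation d β γ σ x x') :
    ∃ i, α < π.prob x - π.prob x' - d i x x' ∧ σ.prob x - σ.prob x' - d i x x' ≤ β := by
  by_contra! hcon
  refine hσ (le_trans hπ (mul_le_mul_of_nonneg_left (Finset.sum_le_sum fun i _ => ?_)
    (by positivity)))
  split_ifs with h1 h2
  · exact le_rfl
  · exact absurd (hcon i h1) h2
  · exact zero_le_one
  · exact le_rfl

/-- A policy that is fair at level `α - ε` is separated by `ε` from the deployed policy on a
reported pair. -/
theorem mul_unfair_le_gap_sub (j : Panel H k m) (v : X) (α γ ε : ℝ) (π σ : Policy H)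
    (x : Fin k → X) (hσ : j.report (α - ε) γ σ x = none) :
    ε * unfair α γ π x j ≤
      π.gap (j.reportedPair v α γ π x) - σ.gap (j.reportedPair v α γ π x) := by
  unfold unfair Panel.reportedPair
  rcases hrep : j.report α γ π x with _ | ⟨s, l⟩
  · simp [Policy.gap]
  · obtain ⟨hne, hviol⟩ := j.violation_of_report_eq_some α γ π x s l hrep
    obtain ⟨i, hi, hi'⟩ := Policy.exists_of_isViolation_of_not hviol
      (j.no_violation_of_report_eq_none _ _ _ _ hσ s l hne)
    simp only [reduceCtorEq, if_false, mul_one, Policy.gap]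
    linarith

/-- The policy that always deploys `h`. -/
noncomputable def Policy.dirac (h : H) : Policy H :=
  open Classical in ⟨Pi.single h 1, single_mem_stdSimplex ℝ h⟩

/-- A zero gap minus a nonnegative distance never exceeds `α`, so no auditor objects, and an empty
fraction is below `γ > 0`. -/
theorem Panel.report_eq_none_of_prob_eq (j : Panel H k m) {α γ : ℝ} (hα : 0 ≤ α) (hγ : 0 < γ)
    (π : Policy H) (hπ : ∀ x x', π.prob x = π.prob x') (x : Fin k → X) :
    j.report α γ π x = none := by
  rcases hrep : j.report α γ π x with _ | ⟨s, l⟩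
  · rfl
  · have hviol := (j.violation_of_report_eq_some α γ π x s l hrep).2
    have hzero : ∀ i, ¬ α < π.prob (x s) - π.prob (x l) - (j.dist i (x s) (x l) : ℝ) := fun i => by
      have := (j.dist i (x s) (x l)).2.1
      rw [hπ (x s) (x l)]
      linarith
    simp only [IsViolation, hzero, if_false, Finset.sum_const_zero, mul_zero] at hviol
    linarith

theorem Policy.prob_dirac_const {h : H} {b : Bool} (hb : h.1 = fun _ => b) (x : X) :
    (Policy.dirac h).prob x = ind b := by
  classical
  rw [Policy.prob, Finset.sum_eq_single h]
  · simp [Policy.dirac, hb]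
  · intro g _ hg
    simp [Policy.dirac, Pi.single_eq_of_ne hg]
  · simp

theorem error_nonneg (π : Policy H) (x : Fin k → X) (y : Fin k → Bool) : 0 ≤ error π x y :=
  Finset.sum_nonneg fun h _ => mul_nonneg (π.2.1 h)
    (Finset.sum_nonneg fun i _ => by split_ifs <;> norm_num)

theorem error_le (π : Policy H) (x : Fin k → X) (y : Fin k → Bool) : error π x y ≤ k := by
  calc error π x y ≤ ∑ h : H, π.1 h * k := by
        refine Finset.sum_le_sum fun h _ => mul_le_mul_of_nonneg_left ?_ (π.2.1 h)
        calc _ ≤ ∑ _i : Fin k, (1 : ℝ) :=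
              Finset.sum_le_sum fun i _ => by split_ifs <;> norm_num
          _ = k := by simp
    _ = k := by rw [← Finset.sum_mul, π.2.2, one_mul]

variable [Nonempty H]

/-- Error regret and unfairness of the reduction are controlled together. -/
theorem expectation_regret_add_unfair_le {η : ℝ} (hη : 0 < η) (env : Environment H k m) (v : X)
    (α γ ε : ℝ) (C T : ℕ) (πstar : Policy H)
    (hstar : ∀ ω : Fin T → H, πstar ∈ fairPolicies env (α - ε) γ ω) :
    expectation (exp2Policy η (reductionEnv env v α γ C)) T (fun ω =>
        learnerError env (exp2Policy η (reductionEnv env v α γ C)) ω - fixedError env ω πstar)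
      + C * ε * expectation (exp2Policy η (reductionEnv env v α γ C)) T
        (learnerUnfair env α γ (exp2Policy η (reductionEnv env v α γ C))) ≤
      2 * (Real.log H.card / η + T * (η / 2 * (2 * k + 4 * C : ℝ) ^ 2)) := by
  set P := exp2Policy η (reductionEnv env v α γ C) with hP
  have hreg := exp2_regret hη (fun t hist π => reductionEnv_isBounded env v α γ C t hist π) πstar T
  have hcard : (Fintype.card (Coord k C) : ℝ) = 2 * k + 4 * C := by
    simp only [Fintype.card_sum, Fintype.card_fin]
    push_cast
    ring
  rw [hcard] at hreg
  refine le_trans ?_ (mul_le_mul_of_nonneg_left hreg zero_le_two)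
  rw [← expectation_const_mul, ← expectation_const_mul, ← expectation_add]
  -- What remains holds on every run, round by round.
  refine expectation_mono _ fun ω => ?_
  unfold learnerError fixedError learnerUnfair
  rw [Finset.mul_sum, Finset.mul_sum, ← Finset.sum_sub_distrib, ← Finset.sum_add_distrib]
  refine Finset.sum_le_sum fun t _ => ?_
  rw [← hP, two_mul_policyCost_sub, mul_assoc]
  have hgap := mul_unfair_le_gap_sub (env t (past ω t)).panel v α γ ε (P t (past ω t)) πstar
    (env t (past ω t)).individuals (hstar ω t)
  linarith [mul_le_mul_of_nonneg_left hgap (Nat.cast_nonneg (α := ℝ) C)]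

end Reduction

/-- Covers the degenerate class: log|H| = 0 makes the learning rate zero, where the regret bound for
Exp2 does not apply. -/
theorem subsingleton_policy (hH : H.card ≤ 1) : Subsingleton (Policy H) := by
  have : Subsingleton H := Fintype.card_le_one_iff_subsingleton.1 (by simpa using hH)
  refine ⟨fun π σ => Subtype.ext (funext fun h => ?_)⟩
  have hsum : ∀ τ : Policy H, τ.1 h = 1 := fun τ => by
    rw [← τ.2.2]
    exact (Fintype.sum_subsingleton _ h).symm
  rw [hsum, hsum]

/-! ### Tuning the parameters -/

/-- The logarithmic term equals D√(DTL) and the variance term √(DTL)/2. -/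
theorem regret_bound_eq {L D T : ℝ} (hL : 0 < L) (hD : 0 < D) (hT : 0 < T) :
    2 * (L / (√(L / (D * T)) / D) + T * (√(L / (D * T)) / D / 2 * D ^ 2)) =
      (2 * D + 1) * √D * √T * √L := by
  have hDT : 0 < D * T := mul_pos hD hT
  set s := √(L / (D * T)) with hs
  have hspos : 0 < s := Real.sqrt_pos.2 (div_pos hL hDT)
  have hsq : L = s ^ 2 * (D * T) := by
    rw [hs, Real.sq_sqrt (div_pos hL hDT).le]
    field_simp
  have hroot : √D * √T * √L = D * T * s := by
    rw [← Real.sqrt_mul hD.le, ← Real.sqrt_mul hDT.le, hsq,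
      show D * T * (s ^ 2 * (D * T)) = (D * T * s) ^ 2 by ring, Real.sqrt_sq (by positivity)]
  rw [mul_assoc, mul_assoc, ← mul_assoc (√D), hroot]
  clear_value s
  subst hsq
  field_simp

/-- The rate at which error and unfairness grow. -/
noncomputable def regretRate (k T n : ℕ) : ℝ :=
  (k : ℝ) ^ ((3 : ℝ) / 2) * (T : ℝ) ^ ((4 : ℝ) / 5) * (Real.log n) ^ ((1 : ℝ) / 2)

theorem regretRate_nonneg (k T n : ℕ) : 0 ≤ regretRate k T n :=
  mul_nonneg (by positivity) (Real.rpow_nonneg (Real.log_natCast_nonneg n) _)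

theorem regret_bound_le {k T C n : ℕ} (hk : 2 ≤ k) (hT : 1 ≤ T)
    (hC : |(C : ℝ) - (T : ℝ) ^ ((1 : ℝ) / 5)| < 1) :
    (2 * (2 * k + 4 * C : ℝ) + 1) * √(2 * k + 4 * C) * √T * √(Real.log n) ≤
      45 * regretRate k T n := by
  have hk' : (2 : ℝ) ≤ k := by exact_mod_cast hk
  have hT' : (1 : ℝ) ≤ T := by exact_mod_cast hT
  have hT0 : (0 : ℝ) < T := by linarith
  set x : ℝ := (T : ℝ) ^ ((1 : ℝ) / 5) with hx
  have hx1 : 1 ≤ x := Real.one_le_rpow hT' (by norm_num)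
  have hCx := (abs_lt.1 hC).2
  have hC0 : (0 : ℝ) ≤ C := Nat.cast_nonneg C
  -- From C < x + 1; the resulting 2k + 4x + 4 ≤ 6kx is tight at k = 2, x = 1.
  have hD : (2 * k + 4 * C : ℝ) ≤ 6 * (k * x) := by nlinarith
  have hsqrtx : √x = (T : ℝ) ^ ((1 : ℝ) / 10) := by
    rw [Real.sqrt_eq_rpow, hx, ← Real.rpow_mul hT0.le]
    norm_num
  have hTpow : (T : ℝ) ^ ((4 : ℝ) / 5) = x * √x * √T := by
    rw [hsqrtx, hx, Real.sqrt_eq_rpow, ← Real.rpow_add hT0, ← Real.rpow_add hT0]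
    norm_num
  have hkpow : (k : ℝ) ^ ((3 : ℝ) / 2) = k * √k := by
    rw [Real.sqrt_eq_rpow, show ((3 : ℝ) / 2) = 1 + 1 / 2 by norm_num,
      Real.rpow_add (by linarith), Real.rpow_one]
  -- Here 5/2 bounds √6; with the factor 18 below it produces 45.
  have hsqrtD : √(2 * k + 4 * C) ≤ 5 / 2 * (√k * √x) := by
    rw [← Real.sqrt_mul (by linarith), ← Real.sqrt_sq (show (0 : ℝ) ≤ 5 / 2 by norm_num),
      ← Real.sqrt_mul (by norm_num)]
    exact Real.sqrt_le_sqrt (by nlinarith)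
  have hlin : 2 * (2 * k + 4 * C : ℝ) + 1 ≤ 18 * (k * x) := by linarith
  rw [regretRate, hTpow, hkpow, ← Real.sqrt_eq_rpow]
  calc (2 * (2 * k + 4 * C : ℝ) + 1) * √(2 * k + 4 * C) * √T * √(Real.log n)
      ≤ 18 * (k * x) * (5 / 2 * (√k * √x)) * √T * √(Real.log n) := by gcongr
    _ = _ := by ring

/-- The trivial bound kT on the comparator's error is affordable because it gets divided by `C`:
T^(1/5) < C + 1 ≤ 2C, while √(log n) ≥ √(log 2) ≥ 2/3. -/
theorem horizon_le {k T C n : ℕ} (hk : 1 ≤ k) (hT : 1 ≤ T) (hC1 : 1 ≤ C)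
    (hC : |(C : ℝ) - (T : ℝ) ^ ((1 : ℝ) / 5)| < 1) (hn : 2 ≤ n) :
    (k : ℝ) * T ≤ C * (3 * regretRate k T n) := by
  have hk' : (1 : ℝ) ≤ k := by exact_mod_cast hk
  have hT0 : (0 : ℝ) < T := by exact_mod_cast hT
  have hC1' : (1 : ℝ) ≤ C := by exact_mod_cast hC1
  have hCx : (T : ℝ) ^ ((1 : ℝ) / 5) ≤ 2 * C := by linarith [(abs_lt.1 hC).1]
  have hlog : 2 / 3 ≤ (Real.log n) ^ ((1 : ℝ) / 2) := by
    rw [← Real.sqrt_eq_rpow]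
    refine Real.le_sqrt_of_sq_le ?_
    have := Real.log_le_log two_pos (show (2 : ℝ) ≤ n by exact_mod_cast hn)
    linarith [Real.log_two_gt_d9]
  have hkpow : (k : ℝ) ≤ (k : ℝ) ^ ((3 : ℝ) / 2) := by
    conv_lhs => rw [← Real.rpow_one (k : ℝ)]
    exact Real.rpow_le_rpow_of_exponent_le hk' (by norm_num)
  have hTpow : (T : ℝ) = (T : ℝ) ^ ((1 : ℝ) / 5) * (T : ℝ) ^ ((4 : ℝ) / 5) := by
    rw [← Real.rpow_add hT0]
    norm_num
  have hT4 : 0 ≤ (T : ℝ) ^ ((4 : ℝ) / 5) := Real.rpow_nonneg hT0.le _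
  calc (k : ℝ) * T = k * ((T : ℝ) ^ ((1 : ℝ) / 5) * (T : ℝ) ^ ((4 : ℝ) / 5)) := by rw [← hTpow]
    _ ≤ (k : ℝ) ^ ((3 : ℝ) / 2) * (2 * C * (T : ℝ) ^ ((4 : ℝ) / 5)) := by gcongr
    _ = C * (3 * ((k : ℝ) ^ ((3 : ℝ) / 2) * (T : ℝ) ^ ((4 : ℝ) / 5) * (2 / 3))) := by ring
    _ ≤ C * (3 * regretRate k T n) := by
        unfold regretRate
        gcongr

/-! ### The guarantees of the learner -/

section Learner

variable {k m : ℕ} (env : Environment H k m) (v : X) (α γ : ℝ) {C T : ℕ}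

theorem learnerUnfair_nonneg (P : (t : ℕ) → (Fin t → H) → Policy H) (ω : Fin T → H) :
    0 ≤ learnerUnfair env α γ P ω :=
  Finset.sum_nonneg fun t _ => by unfold unfair; split_ifs <;> norm_num

theorem dirac_const_mem_fairPolicies {β : ℝ} (hβ : 0 ≤ β) (hγ : 0 < γ) {h : H} {b : Bool}
    (hb : h.1 = fun _ => b) (ω : Fin T → H) : Policy.dirac h ∈ fairPolicies env β γ ω := fun _ =>
  Panel.report_eq_none_of_prob_eq _ hβ hγ _
    (fun x x' => by rw [Policy.prob_dirac_const hb, Policy.prob_dirac_const hb]) _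

theorem fixedError_le (ω : Fin T → H) (π : Policy H) : fixedError env ω π ≤ k * T := by
  refine (Finset.sum_le_sum fun t _ => error_le π _ _).trans_eq ?_
  simp [mul_comm]

theorem fixedError_eq_of_isOblivious (henv : env.IsOblivious) (ω ω' : Fin T → H) :
    fixedError env ω = fixedError env ω' := by
  funext π
  exact Finset.sum_congr rfl fun t _ => by rw [henv t (past ω t) (past ω' t)]

theorem fairPolicies_eq_of_isOblivious (henv : env.IsOblivious) (ω ω' : Fin T → H) :
    fairPolicies env α γ ω = fairPolicies env α γ ω' := by
  ext π
  exact forall_congr' fun t => by rw [henv t (past ω t) (past ω' t)]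

variable [Nonempty H]

theorem learner_regret_add_unfair_le (hH : 2 ≤ H.card) (hk : 2 ≤ k) (hT : 1 ≤ T)
    (hC : |(C : ℝ) - (T : ℝ) ^ ((1 : ℝ) / 5)| < 1) (ε : ℝ) (πstar : Policy H)
    (hstar : ∀ ω : Fin T → H, πstar ∈ fairPolicies env (α - ε) γ ω) :
    expectation (learner env v α γ C T) T (fun ω =>
        learnerError env (learner env v α γ C T) ω - fixedError env ω πstar)
      + C * ε * expectation (learner env v α γ C T) T
        (learnerUnfair env α γ (learner env v α γ C T)) ≤
      45 * regretRate k T H.card := by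
  have hlog : 0 < Real.log H.card := Real.log_pos (by exact_mod_cast hH)
  have hT0 : (0 : ℝ) < T := by exact_mod_cast hT
  have hD : (0 : ℝ) < 2 * k + 4 * C := by positivity
  have hcast : ((2 * k + 4 * C : ℕ) : ℝ) = 2 * k + 4 * C := by push_cast; rfl
  have hη : 0 < exp2Rate T H.card (2 * k + 4 * C) := by
    rw [exp2Rate, hcast]
    positivity
  have h := expectation_regret_add_unfair_le hη env v α γ ε C T πstar hstar
  refine h.trans (le_trans (le_of_eq ?_) (regret_bound_le hk hT hC))
  rw [exp2Rate, hcast]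
  exact regret_bound_eq hlog hD hT0

theorem learner_regret_le (hk : 2 ≤ k) (hT : 1 ≤ T)
    (hC : |(C : ℝ) - (T : ℝ) ^ ((1 : ℝ) / 5)| < 1) {ε : ℝ} (hε : 0 ≤ ε) (πstar : Policy H)
    (hstar : ∀ ω : Fin T → H, πstar ∈ fairPolicies env (α - ε) γ ω) :
    expectation (learner env v α γ C T) T (fun ω =>
        learnerError env (learner env v α γ C T) ω - fixedError env ω πstar) ≤
      45 * regretRate k T H.card := by
  rcases le_or_gt 2 H.card with hH | hH
  · refine le_trans (le_add_of_nonneg_right (mul_nonneg (by positivity) ?_))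
      (learner_regret_add_unfair_le env v α γ hH hk hT hC ε πstar hstar)
    rw [← expectation_const (learner env v α γ C T) T 0]
    exact expectation_mono _ fun ω => learnerUnfair_nonneg env α γ _ ω
  · have := subsingleton_policy (H := H) (by omega)
    refine le_trans (le_of_eq ?_) (mul_nonneg (by norm_num) (regretRate_nonneg _ _ _))
    rw [← expectation_const (learner env v α γ C T) T 0]
    congr 1
    funext ω
    rw [learnerError, fixedError, sub_eq_zero]
    exact Finset.sum_congr rfl fun t _ => by rw [Subsingleton.elim πstar]

/-- Against an oblivious environment the fair set and the comparators' errors are the same on every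
run. The infimum is then a constant that leaves the expectation, and the bound for each fixed fair
policy passes to it. -/
theorem learner_errorRegret_le (hk : 2 ≤ k) (hT : 1 ≤ T)
    (hC : |(C : ℝ) - (T : ℝ) ^ ((1 : ℝ) / 5)| < 1) {ε : ℝ} (hε : 0 ≤ ε) (hεα : ε ≤ α)
    (hγ : 0 < γ) (hconst : ∃ b : Bool, (fun _ => b) ∈ H) (henv : env.IsOblivious) :
    expectation (learner env v α γ C T) T (fun ω =>
        errorRegret env (learner env v α γ C T) (fairPolicies env (α - ε) γ ω) ω) ≤
      45 * regretRate k T H.card := by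
  obtain ⟨b, hb⟩ := hconst
  set ω₀ : Fin T → H := fun _ => ⟨_, hb⟩
  have hU : ∀ ω, fairPolicies env (α - ε) γ ω = fairPolicies env (α - ε) γ ω₀ := fun ω =>
    fairPolicies_eq_of_isOblivious env _ γ henv ω ω₀
  have hF : ∀ ω, fixedError env ω = fixedError env ω₀ := fun ω =>
    fixedError_eq_of_isOblivious env henv ω ω₀
  have hsub : ∀ c : ℝ, expectation (learner env v α γ C T) T
      (fun ω => learnerError env (learner env v α γ C T) ω - c) =
      expectation (learner env v α γ C T) T
        (learnerError env (learner env v α γ C T)) - c := fun c => by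
    simp only [sub_eq_add_neg]
    rw [expectation_add, expectation_const]
  simp only [errorRegret, hU, hF]
  rw [hsub, sub_le_comm]
  -- The constant predictor makes the comparator class nonempty, so the infimum is not the default
  -- value 0.
  refine le_csInf ⟨_, Set.mem_image_of_mem _ (dirac_const_mem_fairPolicies env γ
    (sub_nonneg.2 hεα) hγ (h := ⟨_, hb⟩) rfl ω₀)⟩ ?_
  rintro _ ⟨πstar, hstar, rfl⟩
  have h := learner_regret_le env v α γ hk hT hC hε πstar fun ω => (hU ω).symm ▸ hstar
  simp only [hF] at h
  rw [hsub] at h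
  linarith

theorem learner_unfair_le (hk : 2 ≤ k) (hT : 1 ≤ T) (hC1 : 1 ≤ C)
    (hC : |(C : ℝ) - (T : ℝ) ^ ((1 : ℝ) / 5)| < 1) {ε : ℝ} (hε : 0 < ε) (hεα : ε ≤ α)
    (hγ : 0 < γ) (hconst : ∃ b : Bool, (fun _ => b) ∈ H) :
    expectation (learner env v α γ C T) T (learnerUnfair env α γ (learner env v α γ C T)) ≤
      48 * (1 / ε * regretRate k T H.card) := by
  obtain ⟨b, hb⟩ := hconst
  have hR := regretRate_nonneg k T H.card
  have hfair : ∀ β : ℝ, 0 ≤ β → ∀ ω : Fin T → H,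
      Policy.dirac ⟨_, hb⟩ ∈ fairPolicies env β γ ω := fun β hβ ω =>
    dirac_const_mem_fairPolicies env γ hβ hγ rfl ω
  rcases le_or_gt 2 H.card with hH | hH
  · have hmain := learner_regret_add_unfair_le env v α γ hH hk hT hC ε _
      (hfair _ (sub_nonneg.2 hεα))
    have hlow : -(k * T : ℝ) ≤ expectation (learner env v α γ C T) T (fun ω =>
        learnerError env (learner env v α γ C T) ω
          - fixedError env ω (Policy.dirac ⟨_, hb⟩)) := by
      rw [← expectation_const (learner env v α γ C T) T (-(k * T : ℝ))]
      refine expectation_mono _ fun ω => ?_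
      have h1 : 0 ≤ learnerError env (learner env v α γ C T) ω :=
        Finset.sum_nonneg fun t _ => error_nonneg _ _ _
      linarith [fixedError_le env ω (Policy.dirac ⟨_, hb⟩)]
    have hhor := horizon_le (k := k) (by omega) hT hC1 hC hH
    have hC1' : (1 : ℝ) ≤ C := by exact_mod_cast hC1
    set U := expectation (learner env v α γ C T) T
      (learnerUnfair env α γ (learner env v α γ C T))
    -- 48 = 45 + 3: the regret bound, enlarged by the factor `C ≥ 1`, plus the horizon term.
    have hle : C * (ε * U) ≤ C * (48 * regretRate k T H.card) := by
      have := mul_le_mul_of_nonneg_right hC1' (show 0 ≤ 45 * regretRate k T H.card by positivity)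
      linarith
    have hle' := le_of_mul_le_mul_left hle (by linarith)
    rw [mul_left_comm, one_div_mul_eq_div, le_div_iff₀' hε]
    exact hle'
  · have := subsingleton_policy (H := H) (by omega)
    refine le_trans (le_of_eq ?_) (show 0 ≤ 48 * (1 / ε * regretRate k T H.card) by positivity)
    rw [← expectation_const (learner env v α γ C T) T 0]
    congr 1
    funext ω
    refine Finset.sum_eq_zero fun t _ => ?_
    -- The only policy is the constant predictor, which is never reported.
    rw [Subsingleton.elim (learner env v α γ C T t (past ω t)) (Policy.dirac ⟨_, hb⟩)]
    exact if_pos (hfair α (hε.le.trans hεα) ω t)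

end Learner

end FairOnline

theorem theorem2 :
    ∃ K : ℝ, 0 < K ∧
      ∀ (X : Type u) (H : Finset (X → Bool)) [Nonempty H] (_ : ∃ b : Bool, (fun _ => b) ∈ H)
        (v : X) (k m T C : ℕ) (_ : 2 ≤ k) (_ : 1 ≤ m) (_ : 1 ≤ T)
        (_ : 1 ≤ C) (_ : |(C : ℝ) - (T : ℝ) ^ ((1 : ℝ) / 5)| < 1)
        (α γ : ℝ) (_ : 0 ≤ α) (_ : 0 < γ) (_ : γ ≤ 1)
        (env : FairOnline.Environment H k m) (ε : ℝ) (_ : 0 ≤ ε) (_ : ε ≤ α),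
        (∀ πstar : FairOnline.Policy H,
          (∀ ω : Fin T → H, πstar ∈ FairOnline.fairPolicies env (α - ε) γ ω) →
          FairOnline.expectation (FairOnline.learner env v α γ C T) T
              (fun ω => FairOnline.learnerError env (FairOnline.learner env v α γ C T) ω
                - FairOnline.fixedError env ω πstar)
            ≤ K * ((k : ℝ) ^ ((3 : ℝ) / 2) * (T : ℝ) ^ ((4 : ℝ) / 5)
                * (Real.log H.card) ^ ((1 : ℝ) / 2))) ∧
        (env.IsOblivious →
          FairOnline.expectation (FairOnline.learner env v α γ C T) T
              (fun ω => FairOnline.errorRegret env (FairOnline.learner env v α γ C T)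
                (FairOnline.fairPolicies env (α - ε) γ ω) ω)
            ≤ K * ((k : ℝ) ^ ((3 : ℝ) / 2) * (T : ℝ) ^ ((4 : ℝ) / 5)
                * (Real.log H.card) ^ ((1 : ℝ) / 2))) ∧
        (0 < ε →
          FairOnline.expectation (FairOnline.learner env v α γ C T) T
              (fun ω => FairOnline.learnerUnfair env α γ (FairOnline.learner env v α γ C T) ω)
            ≤ K * (1 / ε * ((k : ℝ) ^ ((3 : ℝ) / 2) * (T : ℝ) ^ ((4 : ℝ) / 5)
                * (Real.log H.card) ^ ((1 : ℝ) / 2)))) := by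
  refine ⟨48, by norm_num, ?_⟩
  intro X H _ hconst v k m T C hk _ hT hC1 hC α γ hα hγ _ env ε hε hεα
  have hR := FairOnline.regretRate_nonneg k T H.card
  have h45 : 45 * FairOnline.regretRate k T H.card ≤ 48 * FairOnline.regretRate k T H.card := by
    linarith
  exact ⟨fun πstar hstar =>
      (FairOnline.learner_regret_le env v α γ hk hT hC hε πstar hstar).trans h45,
    fun henv =>
      (FairOnline.learner_errorRegret_le env v α γ hk hT hC hε hεα hγ hconst henv).trans h45,
    fun hε' => FairOnline.learner_unfair_le env v α γ hk hT hC1 hC hε' hεα hγ hconst⟩
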